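/- Fix integers $1\le C\le N$. In round $t=1,2,\dots$ a policy caches a set of $C$ files out of $[N]$, possibly at random, and then a file $x_t\in[N]$ is requested; a hit occurs if $x_t$ is in the cached set, and a miss otherwise. A finite state machine (FSM) consists of a finite state set, a transition function $g$ with $s_{t+1}=g(s_t,x_t)$, and an initial state; a finite state prefetcher (FSP) is an FSM with a (possibly randomized) choice of the cached $C$-set as a function of the current state. Let $\tilde\pi_S(x^T)$ be the maximum (expected) fraction of hits on $x^T=(x_1,\dots,x_T)$ over all FSPs with at most $S$ states. For $k\ge 0$, the $k$-th order Markov FSM has the $N^k$ states $s_t=(x_{t-1},\dots,x_{t-k})$, with an arbitrary given initial state $s_1\in[N]^k$. Let $L^*_{T,k}$ be the minimum (expected) number of misses on $x^T$ over all FSPs on this FSM, and for a state $s$ let $l^*_{T,s}$ be the minimum, over fixed $C$-sets, of the number of misses on the requests made while the FSM is at $s$. The Sage policy with learning rate $\eta>0$ gives each file $i$ the weight $w(i)=\exp(\eta R(i))$, where $R(i)$ is the number of past requests of $i$, and samples a $C$-set by Madow's systematic sampling with the marginal inclusion probabilities $p(i)=w(i)\,e_{C-1}(w_{-i})/e_C(w)$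 of the Hedge algorithm over all $C$-sets ($e_r$ denotes the $r$-th elementary symmetric polynomial, and $w_{-i}$ is $w$ without the entry $i$). Consider the policy that runs a separate copy of Sage at each state $s$ of the $k$-th order Markov FSM, where the copy at $s$ sees only the requests made at $s$. Write $\pi^{\mathrm{Sage}}_k(x^T)$ for its expected fraction of hits on $x^T$. Theorem. There is a tuning rule $\eta:\mathbb{Z}_{\ge0}\to(0,\infty)$, depending only on $N$ and $C$, such that for all $k\ge0$, $S\ge1$, $T\ge0$, every initial state and every request sequence $x^T$, the policy whose copy of Sage at each state $s$ has the learning rate $\eta(l^*_{T,s})$ satisfies $$T\bigl(\tilde\pi_S(x^T)-\pi^{\mathrm{Sage}}_k(x^T)\bigr)\le T\min\Bigl(1-\tfrac CN,\sqrt{\tfrac{\ln S}{2(k+1)}}\Bigr)+\sqrt{2N^kC\,L^*_{T,k}\ln\tfrac{Ne}{C}}+N^kC\ln\tfrac{Ne}{C}.$$ If, instead, the copy at each state $s$ uses the learning rate $\eta(m_s)$ with integers $m_s\ge0$ fixed in advance, then the same bound, with $\sum_s m_s$ in place of $L^*_{T,k}$, holds for every $x^T$ such that $l^*_{T,s}\le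 m_s$ for all $s$. -/

import Mathlib

open Finset MeasureTheory

/-- A finite state machine over the library `Fin N` of `N` files, with states in `σ`:
a state transition function `g` and an initial state. -/
structure FSM (N : ℕ) (σ : Type) where
  next : σ → Fin N → σ
  init : σ

/-- A (possibly randomized) choice of a set of exactly `C` files out of `N`. -/
abbrev RandomCache (N C : ℕ) : Type := PMF {A : Finset (Fin N) // A.card = C}

/-- A finite state prefetcher: a finite state machine with a (possibly randomized)
prefetching function `f`, which caches `C` files depending on the current state. -/
structure FSP (N C : ℕ) (σ : Type) extends FSM N σ where
  prefetch : σ → RandomCache N C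

noncomputable section

open Classical in
/-- The probability that the requested file `i` lies in the random cache `Y`,
that is, the expected reward `E ⟨x, y⟩`. -/
def RandomCache.hitProb {N C : ℕ} (Y : RandomCache N C) (i : Fin N) : ℝ :=
  ∑ A : {A : Finset (Fin N) // A.card = C}, if i ∈ A.1 then (Y A).toReal else 0

/-- The state in which the machine receives the request `x t`, for requests
`x 0, x 1, x 2, …`; round `t` (counted from `0`) is the round of the request `x t`. -/
def FSM.state {N : ℕ} {σ : Type} (M : FSM N σ) (x : ℕ → Fin N) : ℕ → σ
  | 0 => M.init
  | t + 1 => M.next (M.state x t) (x t)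

/-- The expected number of cache hits of a finite state prefetcher in the first `T` rounds. -/
def FSP.hits {N C : ℕ} {σ : Type} (P : FSP N C σ) (x : ℕ → Fin N) (T : ℕ) : ℝ :=
  ∑ t ∈ range T, (P.prefetch (P.state x t)).hitProb (x t)

/-- The (expected) fraction of cache hits of a finite state prefetcher. -/
def FSP.hitRate {N C : ℕ} {σ : Type} (P : FSP N C σ) (x : ℕ → Fin N) (T : ℕ) : ℝ :=
  P.hits x T / T

/-- The maximum fraction of cache hits in the first `T` rounds achieved by a finite state
prefetcher with at most `S` states. -/
def bestHitRate (N C S : ℕ) (x : ℕ → Fin N) (T : ℕ) : ℝ :=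
  sSup {r : ℝ | ∃ (σ : Type) (_ : Fintype σ) (P : FSP N C σ),
    Fintype.card σ ≤ S ∧ r = P.hitRate x T}

/-- The `k`-th order Markov machine: its state is the tuple of the `k` previous requests, the
most recent one first, and it is updated by a shift. The initial state `s₀` stands for the
requests before the first round. -/
def markovFSM {N : ℕ} (k : ℕ) (s₀ : Fin k → Fin N) : FSM N (Fin k → Fin N) where
  next := fun s a j => (Fin.cons a s : Fin (k + 1) → Fin N) j.castSucc
  init := s₀

/-- The minimum (expected) number of cache misses in the first `T` rounds over all finite state
prefetchers that run on the machine `M`. -/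
def FSM.optMisses {N : ℕ} {σ : Type} (M : FSM N σ) (C : ℕ) (x : ℕ → Fin N) (T : ℕ) : ℝ :=
  sInf {r : ℝ | ∃ f : σ → RandomCache N C,
    r = T - FSP.hits { toFSM := M, prefetch := f } x T}

open Classical in
/-- The minimum number of cache misses that a fixed set of `C` files suffers, in the first `T`
rounds, on the requests that are made while `M` visits the state `s`. -/
def FSM.optMissesAt {N : ℕ} {σ : Type} (M : FSM N σ) (C : ℕ) (x : ℕ → Fin N) (T : ℕ)
    (s : σ) : ℕ :=
  sInf {m : ℕ | ∃ A : Finset (Fin N), A.card = C ∧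
    m = #{t ∈ range T | M.state x t = s ∧ x t ∉ A}}

/-- The marginal inclusion probabilities of Hedge over all sets of `C` files, where the file
`j` has the weight `w j`: `w i * e_{C-1}(w_{-i}) / e_C(w)` with elementary symmetric
polynomials `e`. -/
def sageMarginal {N : ℕ} (C : ℕ) (w : Fin N → ℝ) (i : Fin N) : ℝ :=
  w i * ((univ.erase i).val.map w).esymm (C - 1) / ((univ : Finset (Fin N)).val.map w).esymm C

open Classical in
/-- Madow's systematic sampling of `C` files with inclusion probabilities `p`, as a function of
the seed `u`: the file `j` is selected if `P_{j-1} ≤ u + i < P_j` for some `i < C`, where `P`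
denotes the partial sums of `p`. -/
def madowSample {N : ℕ} (C : ℕ) (p : Fin N → ℝ) (u : ℝ) : Finset (Fin N) :=
  {j | ∃ i : ℕ, i < C ∧ ∑ l ∈ Iio j, p l ≤ u + i ∧ u + i < ∑ l ∈ Iic j, p l}

open Classical in
/-- The number of times that the file `i` was requested before round `t` while `M` was visiting
the state `s`. -/
def FSM.requestCount {N : ℕ} {σ : Type} (M : FSM N σ) (x : ℕ → Fin N) (t : ℕ) (s : σ)
    (i : Fin N) : ℕ :=
  #{τ ∈ range t | M.state x τ = s ∧ x τ = i}

/-- The file weights `w i = exp (η R i)` in round `t` of the copy of Sage with learning rate `η`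
that runs at the state `s` and sees only the requests made while `M` visits `s`. -/
def FSM.sageWeight {N : ℕ} {σ : Type} (M : FSM N σ) (η : ℝ) (x : ℕ → Fin N) (t : ℕ) (s : σ)
    (i : Fin N) : ℝ :=
  Real.exp (η * M.requestCount x t s i)

/-- The set cached in round `t` by the policy that runs a separate copy of Sage at each state
`s` of `M`, with learning rate `η s`, when the seed of Madow's sampling in this round is `u`. -/
def FSM.sageCache {N : ℕ} {σ : Type} (M : FSM N σ) (C : ℕ) (η : σ → ℝ) (x : ℕ → Fin N)
    (t : ℕ) (u : ℝ) : Finset (Fin N) :=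
  madowSample C (sageMarginal C (M.sageWeight (η (M.state x t)) x t (M.state x t))) u

/-- The expected fraction of cache hits in the first `T` rounds of the policy that runs a
separate copy of Sage at each state of `M`; the seed is uniform on `[0, 1)` in each round. -/
def FSM.sageHitRate {N : ℕ} {σ : Type} (M : FSM N σ) (C : ℕ) (η : σ → ℝ) (x : ℕ → Fin N)
    (T : ℕ) : ℝ :=
  (∑ t ∈ range T, volume.real {u : ℝ | u ∈ Set.Ico 0 1 ∧ x t ∈ M.sageCache C η x t u}) / T

end

/-- Hoeffding's bound on the moment generating function of a Bernoulli variable. -/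
theorem one_sub_add_mul_exp_le {q : ℝ} (h0 : 0 ≤ q) (h1 : q ≤ 1) (l : ℝ) :
    1 - q + q * Real.exp l ≤ Real.exp (l * q + l ^ 2 / 8) := by
  set μ : Measure ℝ :=
    ENNReal.ofReal (1 - q) • Measure.dirac 0 + ENNReal.ofReal q • Measure.dirac 1 with hμ
  have hprob : IsProbabilityMeasure μ := ⟨by
    simp only [hμ, Measure.add_apply, Measure.smul_apply, measure_univ, smul_eq_mul, mul_one]
    rw [← ENNReal.ofReal_add (by linarith) h0]; simp⟩
  have hint : ∀ f : ℝ → ℝ, ∫ x, f x ∂μ = (1 - q) * f 0 + q * f 1 := by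
    intro f
    have hi : ∀ a b : ℝ, Integrable f (ENNReal.ofReal a • Measure.dirac b) := fun a b =>
      (integrable_dirac (by simp)).smul_measure (by simp)
    rw [hμ, integral_add_measure (hi _ _) (hi _ _), integral_smul_measure,
      integral_smul_measure, integral_dirac, integral_dirac, ENNReal.toReal_ofReal (by linarith),
      ENNReal.toReal_ofReal h0]
    simp
  have hae : ∀ᵐ x ∂μ, x ∈ Set.Icc (0 : ℝ) 1 := by
    have hd : ∀ b ∈ Set.Icc (0 : ℝ) 1, ∀ᵐ x ∂(Measure.dirac b), x ∈ Set.Icc (0 : ℝ) 1 :=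
      fun b hb => (ae_dirac_iff measurableSet_Icc).2 hb
    rw [hμ, ae_add_measure_iff]
    exact ⟨Measure.ae_smul_measure (hd 0 (by simp)) _, Measure.ae_smul_measure (hd 1 (by simp)) _⟩
  have hs := (ProbabilityTheory.hasSubgaussianMGF_of_mem_Icc (μ := μ) (X := fun x => x)
    aemeasurable_id hae).mgf_le l
  simp only [ProbabilityTheory.mgf, hint] at hs
  have hm := mul_le_mul_of_nonneg_left hs (Real.exp_pos (l * q)).le
  rw [← Real.exp_add] at hm
  have e0 : Real.exp (l * q) * Real.exp (l * (0 - ((1 - q) * 0 + q * 1))) = 1 := by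
    rw [← Real.exp_add]; simp
  have e1 : Real.exp (l * q) * Real.exp (l * (1 - ((1 - q) * 0 + q * 1))) = Real.exp l := by
    rw [← Real.exp_add]; congr 1; ring
  calc 1 - q + q * Real.exp l = (1 - q) * (Real.exp (l * q) *
        Real.exp (l * (0 - ((1 - q) * 0 + q * 1)))) + q * (Real.exp (l * q) *
        Real.exp (l * (1 - ((1 - q) * 0 + q * 1)))) := by rw [e0, e1]; ring
    _ ≤ _ := by
      refine le_trans (le_of_eq (by ring)) (hm.trans (le_of_eq ?_))
      congr 1
      simp
      ring

theorem exp_mul_le_one_sub_add_mul_exp {h : ℝ} (h0 : 0 ≤ h) (h1 : h ≤ 1) (l : ℝ) :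
    Real.exp (l * h) ≤ 1 - h + h * Real.exp l := by
  have := convexOn_exp.2 (Set.mem_univ 0) (Set.mem_univ l) (sub_nonneg.2 h1) h0 (by ring)
  simpa [mul_comm] using this

/-- Hoeffding's lemma for the uniform distribution on a finite set. -/
theorem sum_exp_mul_le {ι : Type*} (B : Finset ι) (f : ι → ℝ) (h0 : ∀ b ∈ B, 0 ≤ f b)
    (h1 : ∀ b ∈ B, f b ≤ 1) (l : ℝ) :
    ∑ b ∈ B, Real.exp (l * f b) ≤
      #B * Real.exp (l * ((∑ b ∈ B, f b) / #B) + l ^ 2 / 8) := by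
  rcases B.eq_empty_or_nonempty with rfl | hB
  · simp
  have hc : (0 : ℝ) < #B := by exact_mod_cast hB.card_pos
  have hq0 : 0 ≤ (∑ b ∈ B, f b) / #B := div_nonneg (sum_nonneg h0) hc.le
  have hq1 : (∑ b ∈ B, f b) / #B ≤ 1 := by
    rw [div_le_one hc]
    simpa using sum_le_sum h1
  calc ∑ b ∈ B, Real.exp (l * f b) ≤ ∑ b ∈ B, (1 - f b + f b * Real.exp l) :=
        sum_le_sum fun b hb => exp_mul_le_one_sub_add_mul_exp (h0 b hb) (h1 b hb) l
    _ = #B * (1 - (∑ b ∈ B, f b) / #B + (∑ b ∈ B, f b) / #B * Real.exp l) := by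
        rw [sum_add_distrib, sum_sub_distrib, ← sum_mul]
        field_simp
        simp
    _ ≤ _ := mul_le_mul_of_nonneg_left (one_sub_add_mul_exp_le hq0 hq1 l) hc.le

/-- The gain from observing the side information `V` in addition to `U` when predicting `Y`
is bounded by the conditional mutual information of the empirical distribution. -/
theorem sum_gain_le_sum_log_card {ι α β γ : Type*} [Fintype α] [Fintype β] [Fintype γ]
    [DecidableEq α] [DecidableEq β] [DecidableEq γ] (B : Finset ι) (U : ι → α) (V : ι → β)
    (Y : ι → γ) (h : α → β → γ → ℝ) (h0 : ∀ u v y, 0 ≤ h u v y) (h1 : ∀ u v y, h u v y ≤ 1)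
    (l : ℝ) :
    ∑ b ∈ B, (l * h (U b) (V b) (Y b) -
        l * ((∑ c ∈ B with U c = U b, h (U b) (V b) (Y c)) / #{c ∈ B | U c = U b}) - l ^ 2 / 8) ≤
      ∑ b ∈ B, (Real.log #{c ∈ B | U c = U b ∧ V c = V b ∧ Y c = Y b} +
        Real.log #{c ∈ B | U c = U b} - Real.log #{c ∈ B | U c = U b ∧ V c = V b} -
        Real.log #{c ∈ B | U c = U b ∧ Y c = Y b}) := by
  set nU : α → ℝ := fun u => #{c ∈ B | U c = u} with hnU
  set nUV : α → β → ℝ := fun u v => #{c ∈ B | U c = u ∧ V c = v} with hnUV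
  set nUY : α → γ → ℝ := fun u y => #{c ∈ B | U c = u ∧ Y c = y} with hnUY
  set n : α → β → γ → ℝ := fun u v y => #{c ∈ B | U c = u ∧ V c = v ∧ Y c = y} with hn
  set m : α → β → ℝ := fun u v => (∑ c ∈ B with U c = u, h u v (Y c)) / nU u with hm
  set E : α → β → γ → ℝ := fun u v y =>
    Real.exp (l * h u v y) * Real.exp (-(l * m u v + l ^ 2 / 8)) with hE
  set G : α → β → γ → ℝ := fun u v y => E u v y * nUV u v * nUY u y / nU u with hG
  have hG0 : ∀ u v y, 0 ≤ G u v y := fun u v y => by simp only [hG, hE, hnU, hnUV, hnUY]; positivity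
  have key : ∑ b ∈ B, G (U b) (V b) (Y b) / n (U b) (V b) (Y b) ≤ #B := by
    calc ∑ b ∈ B, G (U b) (V b) (Y b) / n (U b) (V b) (Y b)
        = ∑ w : α × β × γ, ∑ b ∈ B with (U b, V b, Y b) = w,
            G w.1 w.2.1 w.2.2 / n w.1 w.2.1 w.2.2 := by
          rw [← sum_fiberwise B (fun b => (U b, V b, Y b))]
          refine sum_congr rfl fun w _ => sum_congr rfl fun b hb => ?_
          rw [← (mem_filter.1 hb).2]
      _ = ∑ w : α × β × γ, n w.1 w.2.1 w.2.2 * (G w.1 w.2.1 w.2.2 / n w.1 w.2.1 w.2.2) := by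
          refine sum_congr rfl fun w _ => ?_
          rw [sum_const, nsmul_eq_mul]
          simp only [hn, Prod.ext_iff]
      _ ≤ ∑ w : α × β × γ, G w.1 w.2.1 w.2.2 := by
          refine sum_le_sum fun w _ => ?_
          rcases eq_or_ne (n w.1 w.2.1 w.2.2) 0 with h | h
          · rw [h]; simpa using hG0 _ _ _
          · rw [mul_div_cancel₀ _ h]
      _ = ∑ u, ∑ v, ∑ y, G u v y := by
          rw [Fintype.sum_prod_type]
          exact sum_congr rfl fun u _ => Fintype.sum_prod_type _
      _ ≤ ∑ u, ∑ v, nUV u v := by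
          refine sum_le_sum fun u _ => sum_le_sum fun v _ => ?_
          have hsum : ∑ y, nUY u y * Real.exp (l * h u v y) =
              ∑ c ∈ B with U c = u, Real.exp (l * h u v (Y c)) := by
            rw [← sum_fiberwise _ Y]
            refine sum_congr rfl fun y _ => ?_
            rw [filter_filter, sum_congr rfl (g := fun _ => Real.exp (l * h u v y)) fun c hc => by
              rw [(mem_filter.1 hc).2.2], sum_const, nsmul_eq_mul]
          have hle := sum_exp_mul_le {c ∈ B | U c = u} (fun c => h u v (Y c))
            (fun _ _ => h0 _ _ _) (fun _ _ => h1 _ _ _) l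
          calc ∑ y, G u v y = nUV u v / nU u * Real.exp (-(l * m u v + l ^ 2 / 8)) *
                ∑ y, nUY u y * Real.exp (l * h u v y) := by
                rw [mul_sum]
                refine sum_congr rfl fun y _ => ?_
                simp only [hG, hE]; ring
            _ ≤ nUV u v / nU u * Real.exp (-(l * m u v + l ^ 2 / 8)) *
                (nU u * Real.exp (l * m u v + l ^ 2 / 8)) := by
                rw [hsum]
                exact mul_le_mul_of_nonneg_left hle (by simp only [hnUV, hnU]; positivity)
            _ = nUV u v / nU u * nU u *
                (Real.exp (-(l * m u v + l ^ 2 / 8)) * Real.exp (l * m u v + l ^ 2 / 8)) := by ring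
            _ = nUV u v / nU u * nU u := by rw [← Real.exp_add]; simp
            _ ≤ nUV u v := by
                rcases eq_or_ne (nU u) 0 with h | h
                · rw [h]; simp [hnUV]
                · rw [div_mul_cancel₀ _ h]
      _ = #B := by
          have := sum_fiberwise B (fun b => (U b, V b)) (fun _ => (1 : ℝ))
          rw [Fintype.sum_prod_type] at this
          simpa [hnUV, Prod.ext_iff] using this
  have hpt : ∀ b ∈ B, (l * h (U b) (V b) (Y b) - l * m (U b) (V b) - l ^ 2 / 8) -
      (Real.log (n (U b) (V b) (Y b)) + Real.log (nU (U b)) - Real.log (nUV (U b) (V b)) -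
        Real.log (nUY (U b) (Y b))) ≤ G (U b) (V b) (Y b) / n (U b) (V b) (Y b) - 1 := by
    intro b hb
    have p1 : 0 < n (U b) (V b) (Y b) := by
      simp only [hn, Nat.cast_pos, card_pos]; exact ⟨b, by simp [hb]⟩
    have p2 : 0 < nU (U b) := by
      simp only [hnU, Nat.cast_pos, card_pos]; exact ⟨b, by simp [hb]⟩
    have p3 : 0 < nUV (U b) (V b) := by
      simp only [hnUV, Nat.cast_pos, card_pos]; exact ⟨b, by simp [hb]⟩
    have p4 : 0 < nUY (U b) (Y b) := by
      simp only [hnUY, Nat.cast_pos, card_pos]; exact ⟨b, by simp [hb]⟩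
    have hEp : 0 < E (U b) (V b) (Y b) := by simp only [hE]; positivity
    have hlog := Real.log_le_sub_one_of_pos
      (show 0 < G (U b) (V b) (Y b) / n (U b) (V b) (Y b) by simp only [hG]; positivity)
    refine le_trans (le_of_eq ?_) hlog
    simp only [hG]
    rw [Real.log_div (by positivity) p1.ne', Real.log_div (by positivity) p2.ne',
      Real.log_mul (by positivity) p4.ne', Real.log_mul hEp.ne' p3.ne']
    simp only [hE]
    rw [← Real.exp_add, Real.log_exp]
    ring
  have hsum := sum_le_sum hpt
  rw [sum_sub_distrib, sum_sub_distrib (s := B) (g := fun _ => (1 : ℝ))] at hsum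
  simp only [sum_const, nsmul_eq_mul, mul_one] at hsum
  simp only [hm, hn, hnU, hnUV, hnUY] at hsum key ⊢
  linarith

/-- The entropy of an empirical distribution on a set of at most `S` elements is at most
`log S`. -/
theorem sum_log_div_card_fiber_le {ι β : Type*} [Fintype β] [DecidableEq β] (B : Finset ι)
    (V : ι → β) {S : ℕ} (hS : Fintype.card β ≤ S) :
    ∑ b ∈ B, (Real.log #B - Real.log #{c ∈ B | V c = V b}) ≤ #B * Real.log S := by
  rcases B.eq_empty_or_nonempty with rfl | hB
  · simp
  have hB0 : (0 : ℝ) < #B := by exact_mod_cast hB.card_pos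
  have hβ : 0 < Fintype.card β := Fintype.card_pos_iff.2 ⟨V hB.choose⟩
  have hS0 : (0 : ℝ) < S := by exact_mod_cast hβ.trans_le hS
  set n : β → ℝ := fun v => #{c ∈ B | V c = v} with hn
  have hpt : ∀ b ∈ B, Real.log #B - Real.log (n (V b)) - Real.log S ≤
      #B / S * (1 / n (V b)) - 1 := by
    intro b hb
    have p : 0 < n (V b) := by
      simp only [hn, Nat.cast_pos, card_pos]; exact ⟨b, by simp [hb]⟩
    have := Real.log_le_sub_one_of_pos (show 0 < #B / S * (1 / n (V b)) by positivity)
    rw [Real.log_mul (by positivity) (by positivity), Real.log_div hB0.ne' hS0.ne',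
      one_div, Real.log_inv] at this
    rw [one_div]
    linarith
  have hone : ∑ b ∈ B, 1 / n (V b) ≤ S := by
    rw [← sum_fiberwise B V]
    calc ∑ v, ∑ b ∈ B with V b = v, 1 / n (V b) = ∑ v, n v * (1 / n v) := by
          refine sum_congr rfl fun v _ => ?_
          rw [sum_congr rfl (g := fun _ => 1 / n v) fun b hb => by rw [(mem_filter.1 hb).2],
            sum_const, nsmul_eq_mul]
      _ ≤ ∑ _v : β, (1 : ℝ) := sum_le_sum fun v _ => by
          rw [mul_one_div]; exact div_self_le_one _
      _ ≤ S := by simpa using (by exact_mod_cast hS : (Fintype.card β : ℝ) ≤ S)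
  have hsum := sum_le_sum hpt
  rw [sum_sub_distrib, sum_sub_distrib (s := B) (g := fun _ => (1 : ℝ)), ← mul_sum] at hsum
  simp only [sum_const, nsmul_eq_mul, mul_one] at hsum
  have : #B / S * ∑ b ∈ B, 1 / n (V b) ≤ #B := by
    calc #B / S * ∑ b ∈ B, 1 / n (V b) ≤ #B / S * (S : ℝ) :=
          mul_le_mul_of_nonneg_left hone (by positivity)
      _ = #B := by field_simp
  simp only [hn] at hsum this ⊢
  linarith

theorem mul_esymm_erase_eq_sum {N C : ℕ} (hC : 1 ≤ C) (w : Fin N → ℝ) (i : Fin N) :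
    w i * ((univ.erase i).val.map w).esymm (C - 1) =
      ∑ A ∈ powersetCard C univ with i ∈ A, ∏ j ∈ A, w j := by
  rw [Finset.esymm_map_val, mul_sum]
  refine sum_bij' (fun A _ => insert i A) (fun A _ => A.erase i) ?_ ?_ ?_ ?_ ?_
  · intro A hA
    rw [mem_powersetCard, subset_erase] at hA
    simp [mem_powersetCard, card_insert_of_notMem hA.1.2, hA.2]; omega
  · intro A hA
    simp only [mem_filter, mem_powersetCard_univ] at hA
    simp [mem_powersetCard, card_erase_of_mem hA.2, hA.1, erase_subset_erase]
  · intro A hA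
    rw [mem_powersetCard, subset_erase] at hA
    exact erase_insert hA.1.2
  · intro A hA
    exact insert_erase (mem_filter.1 hA).2
  · intro A hA
    rw [mem_powersetCard, subset_erase] at hA
    rw [prod_insert hA.1.2]

section marginals

variable {N C : ℕ} {w : Fin N → ℝ}

theorem sum_prod_pos (hCN : C ≤ N) (hw : ∀ i, 0 < w i) :
    0 < ∑ A ∈ powersetCard C (univ : Finset (Fin N)), ∏ j ∈ A, w j :=
  sum_pos (fun A _ => prod_pos fun j _ => hw j) (powersetCard_nonempty.2 (by simpa using hCN))

theorem sageMarginal_mul_sum (hC : 1 ≤ C) (hCN : C ≤ N) (hw : ∀ i, 0 < w i) (i : Fin N) :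
    sageMarginal C w i * ∑ A ∈ powersetCard C (univ : Finset (Fin N)), ∏ j ∈ A, w j =
      ∑ A ∈ powersetCard C univ with i ∈ A, ∏ j ∈ A, w j := by
  rw [sageMarginal, mul_esymm_erase_eq_sum hC, Finset.esymm_map_val]
  exact div_mul_cancel₀ _ (sum_prod_pos hCN hw).ne'

theorem sageMarginal_nonneg (hC : 1 ≤ C) (hCN : C ≤ N) (hw : ∀ i, 0 < w i) (i : Fin N) :
    0 ≤ sageMarginal C w i := by
  refine nonneg_of_mul_nonneg_left ?_ (sum_prod_pos hCN hw)
  rw [sageMarginal_mul_sum hC hCN hw]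
  exact sum_nonneg fun A _ => prod_nonneg fun j _ => (hw j).le

theorem sageMarginal_le_one (hC : 1 ≤ C) (hCN : C ≤ N) (hw : ∀ i, 0 < w i) (i : Fin N) :
    sageMarginal C w i ≤ 1 := by
  refine le_of_mul_le_mul_right ?_ (sum_prod_pos hCN hw)
  rw [sageMarginal_mul_sum hC hCN hw, one_mul]
  exact sum_le_sum_of_subset_of_nonneg (filter_subset _ _)
    fun A _ _ => prod_nonneg fun j _ => (hw j).le

theorem sum_sageMarginal (hC : 1 ≤ C) (hCN : C ≤ N) (hw : ∀ i, 0 < w i) :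
    ∑ i, sageMarginal C w i = C := by
  refine mul_right_cancel₀ (sum_prod_pos hCN hw).ne' ?_
  rw [sum_mul, sum_congr rfl fun i _ => sageMarginal_mul_sum hC hCN hw i]
  simp_rw [sum_filter]
  rw [sum_comm, mul_sum]
  refine sum_congr rfl fun A hA => ?_
  rw [← sum_filter, sum_const, nsmul_eq_mul]
  simp [(mem_powersetCard.1 hA).2]

/-- The normalizing constant of Hedge after a request of the file `a`. -/
theorem sum_prod_ite_mul (hC : 1 ≤ C) (hCN : C ≤ N) (hw : ∀ i, 0 < w i) (a : Fin N) (r : ℝ) :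
    ∑ A ∈ powersetCard C univ, ∏ j ∈ A, (if j = a then r * w j else w j) =
      (∑ A ∈ powersetCard C univ, ∏ j ∈ A, w j) * (1 + (r - 1) * sageMarginal C w a) := by
  have h1 : ∀ A : Finset (Fin N), ∏ j ∈ A, (if j = a then r * w j else w j) =
      ∏ j ∈ A, w j + (r - 1) * if a ∈ A then ∏ j ∈ A, w j else 0 := by
    intro A
    rw [prod_congr rfl fun j _ => show (if j = a then r * w j else w j) =
      (if j = a then r else 1) * w j by split_ifs <;> simp, prod_mul_distrib, prod_ite_eq']
    split_ifs <;> ring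
  rw [sum_congr rfl fun A _ => h1 A, sum_add_distrib, ← mul_sum, ← sum_filter,
    ← sageMarginal_mul_sum hC hCN hw]
  ring

/-- Madow's sampling includes each file with at least the prescribed probability. -/
theorem le_volume_mem_madowSample {p : Fin N → ℝ} (h0 : ∀ i, 0 ≤ p i) (h1 : ∀ i, p i ≤ 1)
    (hs : ∑ i, p i = C) (j : Fin N) :
    p j ≤ volume.real {u : ℝ | u ∈ Set.Ico 0 1 ∧ j ∈ madowSample C p u} := by
  rcases (h0 j).eq_or_lt with hj | hj
  · rw [← hj]; exact measureReal_nonneg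
  set lo := ∑ l ∈ Iio j, p l with hlo
  have hhi : ∑ l ∈ Iic j, p l = lo + p j := by
    rw [hlo, ← Iio_insert, sum_insert (by simp), add_comm]
  have hlo0 : 0 ≤ lo := sum_nonneg fun i _ => h0 i
  have hhiC : lo + p j ≤ C := by
    rw [← hhi, ← hs]
    exact sum_le_sum_of_subset_of_nonneg (subset_univ _) fun i _ _ => h0 i
  set a := ⌊lo⌋₊ with ha
  have ha1 : (a : ℝ) ≤ lo := Nat.floor_le hlo0
  have ha2 : lo < a + 1 := Nat.lt_floor_add_one lo
  have hsub : Set.Ico (lo - a) (min (lo + p j - a) 1) ∪ Set.Ico 0 (lo + p j - a - 1) ⊆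
      {u : ℝ | u ∈ Set.Ico 0 1 ∧ j ∈ madowSample C p u} := by
    rintro u (⟨hu1, hu2⟩ | ⟨hu1, hu2⟩)
    · rw [lt_min_iff] at hu2
      refine ⟨⟨by linarith, hu2.2⟩, ?_⟩
      simp only [madowSample, mem_filter, mem_univ, true_and, hhi]
      refine ⟨a, ?_, by linarith, by linarith⟩
      have : (a : ℝ) < C := by linarith
      exact_mod_cast this
    · have := h1 j
      refine ⟨⟨hu1, by linarith⟩, ?_⟩
      simp only [madowSample, mem_filter, mem_univ, true_and, hhi]
      refine ⟨a + 1, ?_, by push_cast; linarith, by push_cast; linarith⟩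
      have : (a : ℝ) + 1 < C := by linarith
      exact_mod_cast this
  have hdisj : Disjoint (Set.Ico (lo - a) (min (lo + p j - a) 1))
      (Set.Ico 0 (lo + p j - a - 1)) := by
    rw [Set.disjoint_left]
    rintro u ⟨hu1, -⟩ ⟨-, hu2⟩
    have := h1 j
    linarith
  have hfin : volume {u : ℝ | u ∈ Set.Ico 0 1 ∧ j ∈ madowSample C p u} ≠ ⊤ :=
    ((measure_mono fun u hu => hu.1).trans_lt (by simp : volume (Set.Ico (0 : ℝ) 1) < ⊤)).ne
  refine le_trans ?_ (measureReal_mono hsub hfin)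
  rw [measureReal_union hdisj measurableSet_Ico measure_Ico_lt_top.ne measure_Ico_lt_top.ne, Real.volume_real_Ico, Real.volume_real_Ico]
  rcases le_total (lo + p j - a) 1 with h | h
  · rw [min_eq_left h]
    have := le_max_left (lo + p j - a - (lo - a)) 0
    have := le_max_right (lo + p j - a - 1 - 0) 0
    linarith
  · rw [min_eq_right h]
    have := le_max_left (1 - (lo - a)) 0
    have := le_max_left (lo + p j - a - 1 - 0) 0
    linarith

end marginals

section regret

variable {N C : ℕ} {σ : Type} (M : FSM N σ)

theorem FSM.sageWeight_pos (η : ℝ) (x : ℕ → Fin N) (t : ℕ) (s : σ) (i : Fin N) :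
    0 < M.sageWeight η x t s i := Real.exp_pos _

open Classical in
theorem FSM.requestCount_succ (x : ℕ → Fin N) (t : ℕ) (s : σ) (i : Fin N) :
    M.requestCount x (t + 1) s i =
      M.requestCount x t s i + if M.state x t = s ∧ x t = i then 1 else 0 := by
  simp only [FSM.requestCount, range_add_one, filter_insert]
  split_ifs with h
  · rw [card_insert_of_notMem (by simp)]
  · rfl

open Classical in
theorem FSM.sageWeight_succ (η : ℝ) (x : ℕ → Fin N) (t : ℕ) (s : σ) (i : Fin N) :
    M.sageWeight η x (t + 1) s i =
      if M.state x t = s then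
        (if i = x t then Real.exp η * M.sageWeight η x t s i else M.sageWeight η x t s i)
      else M.sageWeight η x t s i := by
  simp only [FSM.sageWeight, FSM.requestCount_succ]
  split_ifs with h1 h2 h3 <;> first | (rw [← Real.exp_add]; push_cast; ring_nf) | simp
  all_goals grind

open Classical in
theorem FSM.log_sum_prod_sageWeight_le (hC : 1 ≤ C) (hCN : C ≤ N) (η : ℝ) (x : ℕ → Fin N)
    (s : σ) (T : ℕ) :
    Real.log (∑ A ∈ powersetCard C univ, ∏ j ∈ A, M.sageWeight η x T s j) ≤
      Real.log (N.choose C) + ∑ t ∈ range T, if M.state x t = s then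
        η - (1 - Real.exp (-η)) * (1 - sageMarginal C (M.sageWeight η x t s) (x t)) else 0 := by
  induction T with
  | zero => simp [FSM.sageWeight, FSM.requestCount]
  | succ T ih =>
    rw [sum_range_succ]
    by_cases h : M.state x T = s
    · simp only [FSM.sageWeight_succ, if_pos h]
      have hw := M.sageWeight_pos η x T s
      set p := sageMarginal C (M.sageWeight η x T s) (x T) with hp
      have hp0 : 0 ≤ p := sageMarginal_nonneg hC hCN hw _
      have hp1 : p ≤ 1 := sageMarginal_le_one hC hCN hw _
      have e : 1 + (Real.exp η - 1) * p =
          Real.exp η * (1 - (1 - Real.exp (-η)) * (1 - p)) := by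
        have : Real.exp η * Real.exp (-η) = 1 := by rw [← Real.exp_add]; simp
        linear_combination (p - 1) * this
      have hpos : 0 < 1 + (Real.exp η - 1) * p := by
        rcases hp1.eq_or_lt with h | h
        · rw [h]; have := Real.exp_pos η; linarith
        · nlinarith [Real.exp_pos η]
      have hpos' : 0 < 1 - (1 - Real.exp (-η)) * (1 - p) := by
        rw [e] at hpos; exact pos_of_mul_pos_right hpos (Real.exp_pos η).le
      rw [sum_prod_ite_mul hC hCN hw, Real.log_mul (sum_prod_pos hCN hw).ne' hpos.ne', e,
        Real.log_mul (Real.exp_pos _).ne' hpos'.ne', Real.log_exp]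
      have := Real.log_le_sub_one_of_pos hpos'
      linarith
    · simp only [FSM.sageWeight_succ, if_neg h]
      simpa using ih

open Classical in
theorem FSM.sum_requestCount (x : ℕ → Fin N) (T : ℕ) (s : σ) (A : Finset (Fin N)) :
    ∑ i ∈ A, M.requestCount x T s i = #{t ∈ range T | M.state x t = s ∧ x t ∈ A} := by
  rw [card_eq_sum_card_fiberwise (f := x) (t := A) (fun t ht => (mem_filter.1 ht).2.2)]
  refine sum_congr rfl fun i hi => ?_
  rw [FSM.requestCount, filter_filter]
  congr 1
  ext t
  simp only [mem_filter]
  grind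

open Classical in
/-- The regret bound of Hedge for the copy of Sage at the state `s`. -/
theorem FSM.one_sub_exp_mul_sage_misses_le (hC : 1 ≤ C) (hCN : C ≤ N) (η : ℝ)
    (x : ℕ → Fin N) (s : σ) (T : ℕ) :
    (1 - Real.exp (-η)) * ∑ t ∈ range T with M.state x t = s,
        (1 - sageMarginal C (M.sageWeight η x t s) (x t)) ≤
      Real.log (N.choose C) + η * M.optMissesAt C x T s := by
  obtain ⟨A, hA, hm⟩ : M.optMissesAt C x T s ∈ {m : ℕ | ∃ A : Finset (Fin N), A.card = C ∧
      m = #{t ∈ range T | M.state x t = s ∧ x t ∉ A}} := by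
    obtain ⟨A, -, hA⟩ := exists_subset_card_eq (s := (univ : Finset (Fin N))) (by simpa using hCN)
    exact Nat.sInf_mem ⟨_, A, hA, rfl⟩
  have h1 := M.log_sum_prod_sageWeight_le hC hCN η x s T
  have h2 : η * #{t ∈ range T | M.state x t = s ∧ x t ∈ A} ≤
      Real.log (∑ A ∈ powersetCard C univ, ∏ j ∈ A, M.sageWeight η x T s j) := by
    rw [Real.le_log_iff_exp_le (sum_prod_pos hCN (M.sageWeight_pos η x T s))]
    refine le_trans (le_of_eq ?_) (single_le_sum (f := fun A => ∏ j ∈ A, M.sageWeight η x T s j)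
      (fun A _ => prod_nonneg fun j _ => (M.sageWeight_pos η x T s j).le)
      (mem_powersetCard_univ.2 hA))
    simp only [FSM.sageWeight]
    rw [← Real.exp_sum, ← mul_sum, ← FSM.sum_requestCount]
    push_cast
    rfl
  have h3 : (#{t ∈ range T | M.state x t = s ∧ x t ∈ A} : ℝ) +
      #{t ∈ range T | M.state x t = s ∧ x t ∉ A} = #{t ∈ range T | M.state x t = s} := by
    rw [← filter_filter, ← filter_filter]
    exact_mod_cast card_filter_add_card_filter_not _
  rw [← sum_filter, sum_sub_distrib, sum_const, nsmul_eq_mul, ← mul_sum] at h1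
  rw [hm]
  linear_combination h1 + h2 - η * h3

end regret

theorem mul_log_sub_add_one_le_log_factorial {n : ℕ} (hn : 1 ≤ n) :
    n * Real.log n - n + 1 ≤ Real.log n.factorial := by
  induction n, hn using Nat.le_induction with
  | base => simp
  | succ n hn ih =>
    have hn0 : (0 : ℝ) < n := by exact_mod_cast hn
    have h := Real.log_le_sub_one_of_pos (show 0 < ((n : ℝ) + 1) / n by positivity)
    rw [Real.log_div (by positivity) hn0.ne', add_div, div_self hn0.ne', add_sub_cancel_left,
      le_div_iff₀ hn0] at h
    rw [Nat.factorial_succ, Nat.cast_mul, Real.log_mul (by positivity) (by positivity)]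
    push_cast
    linarith

theorem log_choose_le {N C : ℕ} (hC : 1 ≤ C) (hCN : C ≤ N) :
    Real.log (N.choose C) ≤ C * Real.log (N * Real.exp 1 / C) - 1 := by
  have hC0 : (0 : ℝ) < C := by exact_mod_cast hC
  have hN0 : (0 : ℝ) < N := by exact_mod_cast hC.trans hCN
  have h1 : Real.log (N.choose C) ≤ Real.log ((N : ℝ) ^ C / C.factorial) :=
    Real.log_le_log (by exact_mod_cast Nat.choose_pos hCN) (Nat.choose_le_pow_div C N)
  rw [Real.log_div (by positivity) (by positivity), Real.log_pow] at h1
  rw [Real.log_div (by positivity) hC0.ne', Real.log_mul hN0.ne' (Real.exp_pos _).ne',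
    Real.log_exp]
  linarith [mul_log_sub_add_one_le_log_factorial hC]

theorem one_le_mul_log {N C : ℕ} (hC : 1 ≤ C) (hCN : C ≤ N) :
    1 ≤ C * Real.log (N * Real.exp 1 / C) := by
  have h := log_choose_le hC hCN
  have : 0 ≤ Real.log (N.choose C) := Real.log_natCast_nonneg _
  linarith

/-- The learning rate of Hedge tuned to at most `m` losses of the best expert, where `D - 1`
bounds the logarithm of the number of experts. -/
noncomputable def hedgeRate (D : ℝ) (m : ℕ) : ℝ :=
  if m = 0 then Real.log (1 + 2 * D) else Real.log (1 + Real.sqrt (2 * D / m))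

theorem hedgeRate_pos {D : ℝ} (hD : 1 ≤ D) (m : ℕ) : 0 < hedgeRate D m := by
  rw [hedgeRate]
  split_ifs with h
  · exact Real.log_pos (by linarith)
  · have hm : (0 : ℝ) < m := by exact_mod_cast Nat.pos_of_ne_zero h
    have : 0 < Real.sqrt (2 * D / m) := Real.sqrt_pos.2 (by positivity)
    exact Real.log_pos (by linarith)

theorem le_of_one_sub_exp_hedgeRate_mul_le {D K X : ℝ} {l m : ℕ} (hD : 1 ≤ D) (hK : K ≤ D - 1)
    (hlm : l ≤ m)
    (h : (1 - Real.exp (-hedgeRate D m)) * X ≤ K + hedgeRate D m * l) :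
    X ≤ l + Real.sqrt (2 * D * m) + D - 1 / 2 := by
  rcases Nat.eq_zero_or_pos m with rfl | hm
  · obtain rfl : l = 0 := by omega
    rw [hedgeRate, if_pos rfl, Real.exp_neg, Real.exp_log (by linarith), Nat.cast_zero, mul_zero, add_zero] at h
    have hpos : 0 < 1 + 2 * D := by linarith
    have h2 : 2 * D * X ≤ (1 + 2 * D) * K := by
      have := mul_le_mul_of_nonneg_left h hpos.le
      field_simp at this
      linarith
    simp only [Nat.cast_zero, mul_zero, Real.sqrt_zero]
    nlinarith
  · have hm0 : (0 : ℝ) < m := by exact_mod_cast hm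
    have hη := (hedgeRate_pos hD m)
    have hsinh := Real.self_le_sinh_iff.2 hη.le
    set r := Real.sqrt (2 * D / m) with hr
    have hr0 : 0 < r := Real.sqrt_pos.2 (by positivity)
    have hrsq : r ^ 2 * m = 2 * D := by
      rw [hr, Real.sq_sqrt (by positivity)]; field_simp
    have hrs : r * Real.sqrt (2 * D * m) = 2 * D := by
      rw [hr, ← Real.sqrt_mul (by positivity),
        show 2 * D / m * (2 * D * m) = (2 * D) ^ 2 by field_simp]
      exact Real.sqrt_sq (by positivity)
    have he : Real.exp (hedgeRate D m) = 1 + r := by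
      rw [hedgeRate, if_neg hm.ne', Real.exp_log (by positivity)]
    rw [Real.sinh_eq, Real.exp_neg, he] at hsinh
    rw [Real.exp_neg, he] at h
    have h1 : r * X ≤ (1 + r) * K + (1 + r) * hedgeRate D m * l := by
      have := mul_le_mul_of_nonneg_left h (show 0 ≤ 1 + r by positivity)
      have e : (1 + r) * ((1 - (1 + r)⁻¹) * X) = r * X := by field_simp; ring
      linarith
    have h2 : (1 + r) * hedgeRate D m ≤ r + r ^ 2 / 2 := by
      have := mul_le_mul_of_nonneg_left hsinh (show 0 ≤ 1 + r by positivity)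
      have e : (1 + r) * ((1 + r - (1 + r)⁻¹) / 2) = r + r ^ 2 / 2 := by field_simp; ring
      linarith
    have h3 : (1 + r) * hedgeRate D m * l ≤ (r + r ^ 2 / 2) * l :=
      mul_le_mul_of_nonneg_right h2 (Nat.cast_nonneg _)
    have h4 : r ^ 2 / 2 * l ≤ r ^ 2 / 2 * m :=
      mul_le_mul_of_nonneg_left (by exact_mod_cast hlm) (by positivity)
    have h5 : (1 + r) * K ≤ (1 + r) * (D - 1) := mul_le_mul_of_nonneg_left hK (by positivity)
    refine le_of_mul_le_mul_left ?_ hr0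
    nlinarith

section hitProb

variable {N C : ℕ}

theorem RandomCache.sum_toReal (R : RandomCache N C) : ∑ A, (R A).toReal = 1 := by
  have h := R.tsum_coe
  rw [tsum_fintype] at h
  rw [← ENNReal.toReal_sum fun A _ => R.apply_ne_top A, h, ENNReal.toReal_one]

theorem RandomCache.hitProb_nonneg (R : RandomCache N C) (i : Fin N) : 0 ≤ R.hitProb i :=
  sum_nonneg fun A _ => by split_ifs <;> simp

theorem RandomCache.hitProb_le_one (R : RandomCache N C) (i : Fin N) : R.hitProb i ≤ 1 := by
  rw [← R.sum_toReal]
  exact sum_le_sum fun A _ => by split_ifs <;> simp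

/-- A random cache is no better than the best deterministic one. -/
theorem RandomCache.sum_hitProb_le (R : RandomCache N C) {ι : Type*} (B : Finset ι)
    (Y : ι → Fin N) (c : ℝ)
    (hc : ∀ A : Finset (Fin N), A.card = C → (#{b ∈ B | Y b ∈ A} : ℝ) ≤ c) :
    ∑ b ∈ B, R.hitProb (Y b) ≤ c := by
  simp only [RandomCache.hitProb]
  rw [sum_comm]
  calc ∑ A : {A : Finset (Fin N) // A.card = C}, ∑ b ∈ B, (if Y b ∈ A.1 then (R A).toReal else 0)
      = ∑ A : {A : Finset (Fin N) // A.card = C}, (R A).toReal * #{b ∈ B | Y b ∈ A.1} := by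
        refine sum_congr rfl fun A _ => ?_
        rw [← sum_filter, sum_const, nsmul_eq_mul, mul_comm]
    _ ≤ ∑ A : {A : Finset (Fin N) // A.card = C}, (R A).toReal * c :=
        sum_le_sum fun A _ => mul_le_mul_of_nonneg_left (hc _ A.2) (by simp)
    _ = c := by rw [← sum_mul, R.sum_toReal, one_mul]

/-- The gain of a prefetcher with the information `(U, V)` over the best prefetcher with the
information `U` only. -/
theorem exists_forall_sum_hitProb_le {ι α β : Type*} [Fintype α] [Fintype β] [DecidableEq α]
    [DecidableEq β] (hCN : C ≤ N) (B : Finset ι) (U : ι → α) (V : ι → β) (Y : ι → Fin N)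
    (f : α → β → RandomCache N C) :
    ∃ A : α → Finset (Fin N), (∀ u, (A u).card = C) ∧ ∀ l : ℝ, 0 ≤ l →
      l * ∑ b ∈ B, (f (U b) (V b)).hitProb (Y b) ≤ l * #{b ∈ B | Y b ∈ A (U b)} +
        #B * (l ^ 2 / 8) +
        ∑ b ∈ B, (Real.log #{c ∈ B | U c = U b ∧ V c = V b ∧ Y c = Y b} +
          Real.log #{c ∈ B | U c = U b} - Real.log #{c ∈ B | U c = U b ∧ V c = V b} -
          Real.log #{c ∈ B | U c = U b ∧ Y c = Y b}) := by
  have hex : ∀ u, ∃ A ∈ powersetCard C (univ : Finset (Fin N)),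
      ∀ A' ∈ powersetCard C (univ : Finset (Fin N)),
        #{c ∈ B | U c = u ∧ Y c ∈ A'} ≤ #{c ∈ B | U c = u ∧ Y c ∈ A} := fun u =>
    exists_max_image _ _ (powersetCard_nonempty.2 (by simpa using hCN))
  choose A hA hmax using hex
  refine ⟨A, fun u => mem_powersetCard_univ.1 (hA u), fun l hl => ?_⟩
  have hgain := sum_gain_le_sum_log_card B U V Y (fun u v y => (f u v).hitProb y)
    (fun _ _ _ => RandomCache.hitProb_nonneg _ _) (fun _ _ _ => RandomCache.hitProb_le_one _ _) l
  rw [sum_sub_distrib, sum_sub_distrib, ← mul_sum, ← mul_sum, sum_const, nsmul_eq_mul] at hgain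
  have hbest : ∑ b ∈ B, (∑ c ∈ B with U c = U b, (f (U b) (V b)).hitProb (Y c)) /
      #{c ∈ B | U c = U b} ≤ #{b ∈ B | Y b ∈ A (U b)} := by
    calc ∑ b ∈ B, (∑ c ∈ B with U c = U b, (f (U b) (V b)).hitProb (Y c)) /
          #{c ∈ B | U c = U b}
        ≤ ∑ b ∈ B, (#{c ∈ B | U c = U b ∧ Y c ∈ A (U b)} : ℝ) / #{c ∈ B | U c = U b} := by
          refine sum_le_sum fun b _ => div_le_div_of_nonneg_right ?_ (Nat.cast_nonneg _)
          refine RandomCache.sum_hitProb_le _ _ _ _ fun A' hA' => ?_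
          rw [filter_filter]
          exact_mod_cast hmax (U b) A' (mem_powersetCard_univ.2 hA')
      _ = ∑ u, (#{c ∈ B | U c = u} : ℝ) *
            (#{c ∈ B | U c = u ∧ Y c ∈ A u} / #{c ∈ B | U c = u}) := by
          rw [← sum_fiberwise B U]
          refine sum_congr rfl fun u _ => ?_
          rw [sum_congr rfl fun b hb => by rw [(mem_filter.1 hb).2], sum_const, nsmul_eq_mul]
      _ ≤ ∑ u, (#{c ∈ B | U c = u ∧ Y c ∈ A u} : ℝ) := by
          refine sum_le_sum fun u _ => ?_
          rcases eq_or_ne (#{c ∈ B | U c = u} : ℝ) 0 with h | h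
          · rw [h]; simp
          · rw [mul_div_cancel₀ _ h]
      _ = #{b ∈ B | Y b ∈ A (U b)} := by
          rw [card_eq_sum_card_fiberwise (f := U) (t := univ) (fun _ _ => by simp)]
          push_cast
          refine sum_congr rfl fun u _ => ?_
          rw [filter_filter]
          congr 2
          ext c
          simp only [mem_filter]
          grind
  have := mul_le_mul_of_nonneg_left hbest hl
  linarith

end hitProb

section machines

variable {N C : ℕ} {σ : Type} (M : FSM N σ)

open Classical in
theorem FSM.optMissesAt_le (x : ℕ → Fin N) (T : ℕ) (s : σ) {A : Finset (Fin N)}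
    (hA : A.card = C) :
    M.optMissesAt C x T s ≤ #{t ∈ range T | M.state x t = s ∧ x t ∉ A} :=
  Nat.sInf_le ⟨A, hA, rfl⟩

theorem FSM.sum_optMissesAt_le_card [Fintype σ] (x : ℕ → Fin N) (T : ℕ)
    (A : σ → Finset (Fin N)) (hA : ∀ s, (A s).card = C) :
    ∑ s, M.optMissesAt C x T s ≤ #{t ∈ range T | x t ∉ A (M.state x t)} := by
  classical
  rw [card_eq_sum_card_fiberwise (f := M.state x) (t := univ) (fun _ _ => by simp)]
  refine sum_le_sum fun s _ => (M.optMissesAt_le x T s (hA s)).trans (card_le_card fun t => ?_)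
  simp only [mem_filter]
  grind

theorem FSM.sum_optMissesAt_le_optMisses [Fintype σ] (hCN : C ≤ N) (x : ℕ → Fin N) (T : ℕ) :
    (∑ s, (M.optMissesAt C x T s : ℝ)) ≤ M.optMisses C x T := by
  classical
  obtain ⟨A, -, hA⟩ := exists_subset_card_eq (s := (univ : Finset (Fin N))) (by simpa using hCN)
  refine le_csInf ⟨_, fun _ => PMF.pure ⟨A, hA⟩, rfl⟩ ?_
  rintro r ⟨f, rfl⟩
  have hs : ∀ s, ∑ t ∈ range T with M.state x t = s, (f s).hitProb (x t) ≤
      #{t ∈ range T | M.state x t = s} - M.optMissesAt C x T s := by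
    intro s
    refine RandomCache.sum_hitProb_le _ _ _ _ fun A hA => ?_
    have h1 : (M.optMissesAt C x T s : ℝ) ≤ #{t ∈ range T | M.state x t = s ∧ x t ∉ A} := by
      exact_mod_cast M.optMissesAt_le x T s hA
    have h2 : (#{t ∈ {t ∈ range T | M.state x t = s} | x t ∈ A} : ℝ) +
        #{t ∈ range T | M.state x t = s ∧ x t ∉ A} = #{t ∈ range T | M.state x t = s} := by
      rw [← filter_filter]
      exact_mod_cast card_filter_add_card_filter_not _
    linarith
  have h1 : FSP.hits { toFSM := M, prefetch := f } x T =
      ∑ s, ∑ t ∈ range T with M.state x t = s, (f s).hitProb (x t) := by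
    rw [FSP.hits, ← sum_fiberwise _ (M.state x)]
    exact sum_congr rfl fun s _ => sum_congr rfl fun t ht => by rw [(mem_filter.1 ht).2]
  have h2 : ∑ s, (#{t ∈ range T | M.state x t = s} : ℝ) = T := by
    have := card_eq_sum_card_fiberwise (f := M.state x) (s := range T) (t := univ)
      (fun _ _ => by simp)
    rw [card_range] at this
    exact_mod_cast this.symm
  have h3 := sum_le_sum fun s (_ : s ∈ univ) => hs s
  rw [sum_sub_distrib, h2, ← h1] at h3
  linarith

/-- A suitable static cache attains the hit rate `C / N`. -/
theorem exists_card_le_card_hits (hC : 1 ≤ C) (hCN : C ≤ N) (x : ℕ → Fin N) (T : ℕ) :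
    ∃ A : Finset (Fin N), A.card = C ∧ T * C ≤ N * #{t ∈ range T | x t ∈ A} := by
  have : NeZero N := ⟨by omega⟩
  obtain ⟨A, -, hA⟩ := exists_subset_card_eq (s := (univ : Finset (Fin N))) (by simpa using hCN)
  have hsum : ∑ r : Fin N, #{t ∈ range T | x t - r ∈ A} = T * C := by
    simp only [card_filter]
    rw [sum_comm, sum_congr rfl (g := fun _ => C), sum_const, card_range, smul_eq_mul]
    intro t _
    rw [← card_filter, ← hA]
    refine card_bij' (fun r _ => x t - r) (fun a _ => x t - a) ?_ ?_ ?_ ?_ <;> simp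
  obtain ⟨r, -, hr⟩ : ∃ r ∈ (univ : Finset (Fin N)), T * C ≤ N * #{t ∈ range T | x t - r ∈ A} := by
    refine exists_le_of_sum_le univ_nonempty ?_
    rw [sum_const, ← mul_sum, hsum]
    simp
  refine ⟨A.map (Equiv.addRight r).toEmbedding, by simpa using hA, ?_⟩
  rw [filter_congr fun t _ => show x t ∈ A.map (Equiv.addRight r).toEmbedding ↔ x t - r ∈ A by
    simp [sub_eq_add_neg]]
  exact hr

theorem FSM.sum_optMissesAt_le_mul [Fintype σ] (hC : 1 ≤ C) (hCN : C ≤ N) (x : ℕ → Fin N)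
    (T : ℕ) : (∑ s, (M.optMissesAt C x T s : ℝ)) ≤ T * (1 - C / N) := by
  obtain ⟨A, hA, h⟩ := exists_card_le_card_hits hC hCN x T
  have h1 := M.sum_optMissesAt_le_card x T (fun _ => A) fun _ => hA
  have h2 : #{t ∈ range T | x t ∈ A} + #{t ∈ range T | x t ∉ A} = T := by
    rw [card_filter_add_card_filter_not, card_range]
  have h1' : (∑ s, (M.optMissesAt C x T s : ℝ)) ≤ #{t ∈ range T | x t ∉ A} := by
    exact_mod_cast h1
  have h2' : (#{t ∈ range T | x t ∈ A} : ℝ) + #{t ∈ range T | x t ∉ A} = T := by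
    exact_mod_cast h2
  have h' : (T : ℝ) * C ≤ N * #{t ∈ range T | x t ∈ A} := by exact_mod_cast h
  have hN0 : (0 : ℝ) < N := by exact_mod_cast hC.trans hCN
  have h3 : (T : ℝ) * C / N ≤ #{t ∈ range T | x t ∈ A} := by
    rw [div_le_iff₀ hN0]; linarith
  rw [mul_sub, mul_one, ← mul_div_assoc]
  linarith

theorem FSM.state_congr {x y : ℕ → Fin N} {t : ℕ} (h : ∀ i < t, x i = y i) :
    M.state x t = M.state y t := by
  induction t with
  | zero => rfl
  | succ t ih =>
    rw [FSM.state, FSM.state, ih fun i hi => h i (by omega), h t (by omega)]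

theorem FSM.state_add (x : ℕ → Fin N) (b j : ℕ) :
    M.state x (b + j) = FSM.state ⟨M.next, M.state x b⟩ (fun i => x (b + i)) j := by
  induction j with
  | zero => rfl
  | succ j ih => rw [← add_assoc, FSM.state, ih, FSM.state]

theorem markovFSM_state_apply {k : ℕ} (s₀ : Fin k → Fin N) (x : ℕ → Fin N) {t : ℕ} (i : Fin k)
    (hi : (i : ℕ) < t) : (markovFSM k s₀).state x t i = x (t - 1 - i) := by
  induction t generalizing i with
  | zero => omega
  | succ t ih =>
    obtain ⟨i, hik⟩ := i
    cases i with
    | zero => rfl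
    | succ i =>
      have : (markovFSM k s₀).state x (t + 1) ⟨i + 1, hik⟩ =
          (markovFSM k s₀).state x t ⟨i, by omega⟩ := rfl
      rw [this, ih ⟨i, by omega⟩ (by simp at hi ⊢; omega)]
      congr 1
      simp only
      omega

end machines

theorem sum_range_le_sum_range_add {g : ℕ → ℝ} (h0 : ∀ t, 0 ≤ g t) (h1 : ∀ t, g t ≤ 1)
    (T j : ℕ) : ∑ t ∈ range T, g t ≤ ∑ b ∈ range T, g (b + j) + j := by
  have e := sum_range_add g j T
  calc ∑ t ∈ range T, g t ≤ ∑ t ∈ range (j + T), g t :=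
        sum_le_sum_of_subset_of_nonneg (range_subset_range.2 (by omega)) fun t _ _ => h0 t
    _ = ∑ t ∈ range j, g t + ∑ b ∈ range T, g (b + j) := by
        rw [sum_range_add]; simp_rw [add_comm j]
    _ ≤ ∑ b ∈ range T, g (b + j) + j := by
        have : ∑ t ∈ range j, g t ≤ j := by simpa using sum_le_sum fun t (_ : t ∈ range j) => h1 t
        linarith

theorem le_mul_sqrt_of_forall_mul_le {a T X : ℝ} (ha : 0 ≤ a) (hT : 0 ≤ T)
    (h : ∀ l, 0 ≤ l → l * X ≤ T * (l ^ 2 / 8 + a)) : X ≤ T * Real.sqrt (a / 2) := by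
  rcases ha.eq_or_lt with rfl | ha
  · simp only [zero_div, Real.sqrt_zero, mul_zero]
    by_contra! hX
    have := h (4 * X / (T + 1)) (by positivity)
    have e1 : 4 * X / (T + 1) * X = 4 * X ^ 2 / (T + 1) := by ring
    have e2 : T * ((4 * X / (T + 1)) ^ 2 / 8 + 0) = 2 * X ^ 2 / (T + 1) * (T / (T + 1)) := by
      field_simp; ring
    have h3 : T / (T + 1) ≤ 1 := by rw [div_le_one (by positivity)]; linarith
    have h4 : 0 < 2 * X ^ 2 / (T + 1) := by positivity
    have h5 := mul_le_mul_of_nonneg_left h3 h4.le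
    have e3 : 4 * X ^ 2 / (T + 1) = 2 * (2 * X ^ 2 / (T + 1)) := by ring
    rw [e1, e2, e3] at this
    linarith
  · set r := Real.sqrt (a / 2) with hr
    have hr0 : 0 < r := Real.sqrt_pos.2 (by positivity)
    have hra : r ^ 2 = a / 2 := Real.sq_sqrt (by positivity)
    have := h (4 * r) (by positivity)
    refine le_of_mul_le_mul_left ?_ (show 0 < 4 * r by positivity)
    nlinarith

section comparison

variable {N C : ℕ} {σ : Type}

/-- One step of the comparison with the Markov machine, for contexts of length `j`. -/
theorem FSP.mul_hits_le [Fintype σ] [DecidableEq σ] (hCN : C ≤ N) (P : FSP N C σ)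
    {k j : ℕ} (hjk : j ≤ k) (s₀ : Fin k → Fin N) (x : ℕ → Fin N) (T : ℕ) {l : ℝ} (hl : 0 ≤ l) :
    l * (P.hits x T - (T - ∑ s, ((markovFSM k s₀).optMissesAt C x T s : ℝ)) - 2 * j) ≤
      T * (l ^ 2 / 8) + ∑ b ∈ range T,
        ((Real.log #{c ∈ range T | (∀ i < j + 1, x (c + i) = x (b + i)) ∧
            P.state x c = P.state x b} -
          Real.log #{c ∈ range T | ∀ i < j + 1, x (c + i) = x (b + i)}) -
        (Real.log #{c ∈ range T | (∀ i < j, x (c + i) = x (b + i)) ∧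
            P.state x c = P.state x b} -
          Real.log #{c ∈ range T | ∀ i < j, x (c + i) = x (b + i)})) := by
  set U : ℕ → Fin j → Fin N := fun b i => x (b + i) with hU
  set ext : (Fin j → Fin N) → ℕ → Fin N := fun u i => if h : i < j then u ⟨i, h⟩ else x 0
    with hext
  obtain ⟨A, hA, hgain⟩ := exists_forall_sum_hitProb_le hCN (range T) U (P.state x)
    (fun b => x (b + j))
    (fun u v => P.prefetch (FSM.state ⟨P.next, v⟩ (ext u) j))
  have hstate : ∀ b, FSM.state ⟨P.next, P.state x b⟩ (ext (U b)) j = P.state x (b + j) := by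
    intro b
    rw [FSM.state_add]
    exact FSM.state_congr _ fun i hi => by simp [hext, hU, hi]
  simp only [hstate, card_range] at hgain
  have hUeq : ∀ b c, U c = U b ↔ ∀ i < j, x (c + i) = x (b + i) := fun b c => by
    simp [hU, funext_iff, Fin.forall_iff]
  have hUY : ∀ b c, (U c = U b ∧ x (c + j) = x (b + j)) ↔
      ∀ i < j + 1, x (c + i) = x (b + i) := fun b c => by
    rw [hUeq, Nat.forall_lt_succ_right]
  have hUVY : ∀ b c, (U c = U b ∧ P.state x c = P.state x b ∧ x (c + j) = x (b + j)) ↔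
      (∀ i < j + 1, x (c + i) = x (b + i)) ∧ P.state x c = P.state x b := fun b c => by
    rw [← hUY]; tauto
  simp only [hUVY, hUY] at hgain
  simp only [hUeq] at hgain
  have hhits : P.hits x T ≤
      ∑ b ∈ range T, (P.prefetch (P.state x (b + j))).hitProb (x (b + j)) + j :=
    sum_range_le_sum_range_add (fun t => RandomCache.hitProb_nonneg _ _)
      (fun t => RandomCache.hitProb_le_one _ _) T j
  set f : (Fin k → Fin N) → Finset (Fin N) :=
    fun s => A fun i => s ⟨j - 1 - i, by have := i.2; omega⟩ with hf
  have hfU : ∀ b, f ((markovFSM k s₀).state x (b + j)) = A (U b) := by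
    intro b
    simp only [hf]
    congr 1
    ext1 i
    have hi := i.2
    rw [markovFSM_state_apply _ _ _ (by simp only; omega)]
    simp only [hU]
    congr 1
    omega
  have hmiss : (∑ s, ((markovFSM k s₀).optMissesAt C x T s : ℝ)) ≤
      (T - #{b ∈ range T | x (b + j) ∈ A (U b)}) + j := by
    have h1 : (∑ s, ((markovFSM k s₀).optMissesAt C x T s : ℝ)) ≤
        #{t ∈ range T | x t ∉ f ((markovFSM k s₀).state x t)} := by
      exact_mod_cast (markovFSM k s₀).sum_optMissesAt_le_card x T f fun s => hA _
    have h2 := sum_range_le_sum_range_add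
      (g := fun t => if x t ∉ f ((markovFSM k s₀).state x t) then 1 else 0)
      (fun t => by split_ifs <;> simp) (fun t => by split_ifs <;> simp) T j
    simp only [hfU, sum_boole] at h2
    have h3 : (#{b ∈ range T | x (b + j) ∈ A (U b)} : ℝ) +
        #{b ∈ range T | x (b + j) ∉ A (U b)} = T := by
      have := card_filter_add_card_filter_not (s := range T) fun b => x (b + j) ∈ A (U b)
      rw [card_range] at this
      exact_mod_cast this
    linarith
  have hg := hgain l hl
  have h1 := mul_le_mul_of_nonneg_left hhits hl
  have h2 := mul_le_mul_of_nonneg_left hmiss hl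
  have h3 : ∀ a b c d : ℝ, a + b - c - d = (a - d) - (c - b) := fun a b c d => by ring
  simp only [h3] at hg
  linarith

/-- A finite state prefetcher with `S` states gains at most `√(log S / (2 (k + 1)))` per round
over the `k`-th order Markov machine, up to `k` rounds lost at the ends. -/
theorem FSP.hits_le [Fintype σ] (hCN : C ≤ N) (P : FSP N C σ) {S : ℕ}
    (hS : Fintype.card σ ≤ S) {k : ℕ} (s₀ : Fin k → Fin N) (x : ℕ → Fin N) (T : ℕ) :
    P.hits x T ≤ T - ∑ s, ((markovFSM k s₀).optMissesAt C x T s : ℝ) +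
      T * Real.sqrt (Real.log S / (2 * ((k : ℝ) + 1))) + k := by
  classical
  have hk : (0 : ℝ) < k + 1 := by positivity
  have key := le_mul_sqrt_of_forall_mul_le (a := Real.log S / (k + 1)) (T := T)
    (X := P.hits x T - (T - ∑ s, ((markovFSM k s₀).optMissesAt C x T s : ℝ)) - k)
    (div_nonneg (Real.log_natCast_nonneg _) hk.le) (Nat.cast_nonneg _) fun l hl => by
      have h := sum_le_sum fun j (hj : j ∈ range (k + 1)) =>
        P.mul_hits_le hCN (Nat.lt_succ_iff.1 (mem_range.1 hj)) s₀ x T hl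
      rw [sum_add_distrib, sum_comm (s := range (k + 1)), sum_const, card_range, nsmul_eq_mul,
        ← mul_sum, sum_sub_distrib, sum_const, card_range, nsmul_eq_mul, ← mul_sum] at h
      have hlog : ∀ b ∈ range T, ∑ j ∈ range (k + 1),
          ((Real.log #{c ∈ range T | (∀ i < j + 1, x (c + i) = x (b + i)) ∧
              P.state x c = P.state x b} -
            Real.log #{c ∈ range T | ∀ i < j + 1, x (c + i) = x (b + i)}) -
          (Real.log #{c ∈ range T | (∀ i < j, x (c + i) = x (b + i)) ∧
              P.state x c = P.state x b} -
            Real.log #{c ∈ range T | ∀ i < j, x (c + i) = x (b + i)})) ≤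
          Real.log #(range T) - Real.log #{c ∈ range T | P.state x c = P.state x b} := by
        intro b hb
        rw [sum_range_sub (fun j => Real.log #{c ∈ range T | (∀ i < j, x (c + i) = x (b + i)) ∧
              P.state x c = P.state x b} -
            Real.log #{c ∈ range T | ∀ i < j, x (c + i) = x (b + i)})]
        have hle : Real.log #{c ∈ range T | (∀ i < k + 1, x (c + i) = x (b + i)) ∧
              P.state x c = P.state x b} ≤
            Real.log #{c ∈ range T | ∀ i < k + 1, x (c + i) = x (b + i)} := by
          refine Real.log_le_log ?_ ?_
          · rw [Nat.cast_pos, card_pos]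
            exact ⟨b, by simpa using hb⟩
          · exact_mod_cast card_le_card fun c hc => by
              simp only [mem_filter] at hc ⊢
              exact ⟨hc.1, hc.2.1⟩
        simp only [Nat.not_lt_zero, false_imp_iff, implies_true, true_and, filter_true]
        linarith
      have hent := (sum_le_sum hlog).trans (sum_log_div_card_fiber_le (range T) (P.state x) hS)
      rw [card_range] at hent
      have hid : ∑ j ∈ range (k + 1), (j : ℝ) = (k + 1) * k / 2 := by
        have := sum_range_id_mul_two (k + 1)
        rw [Nat.add_sub_cancel] at this
        have h' : ((∑ j ∈ range (k + 1), j : ℕ) : ℝ) * 2 = (k + 1) * k := by exact_mod_cast this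
        rw [← Nat.cast_sum]
        linarith
      rw [hid] at h
      push_cast at h
      refine le_of_mul_le_mul_left ?_ hk
      have e : ((k : ℝ) + 1) * (T * (l ^ 2 / 8 + Real.log S / (k + 1))) =
          (k + 1) * (T * (l ^ 2 / 8)) + T * Real.log S := by field_simp
      rw [e]
      linarith
  rw [div_div, mul_comm ((k : ℝ) + 1) 2] at key
  linarith

theorem FSP.hits_le_min [Fintype σ] (hC : 1 ≤ C) (hCN : C ≤ N) (P : FSP N C σ) {S : ℕ}
    (hS : Fintype.card σ ≤ S) {k : ℕ} (s₀ : Fin k → Fin N) (x : ℕ → Fin N) (T : ℕ) :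
    P.hits x T ≤ T - ∑ s, ((markovFSM k s₀).optMissesAt C x T s : ℝ) +
      T * min (1 - (C : ℝ) / N) (Real.sqrt (Real.log S / (2 * ((k : ℝ) + 1)))) +
      (N : ℝ) ^ k / 2 := by
  have hT : P.hits x T ≤ T := by
    simpa [FSP.hits] using sum_le_sum fun t (_ : t ∈ range T) =>
      RandomCache.hitProb_le_one (P.prefetch (P.state x t)) (x t)
  have hN : (0 : ℝ) ≤ (N : ℝ) ^ k / 2 := by positivity
  have hstat := (markovFSM k s₀).sum_optMissesAt_le_mul hC hCN x T
  rcases min_choice (1 - (C : ℝ) / N) (Real.sqrt (Real.log S / (2 * ((k : ℝ) + 1)))) with h | h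
  · rw [h]; linarith
  · rcases (hC.trans hCN).eq_or_lt with h1 | h2
    · have hone : (C : ℝ) / N = 1 := by
        rw [← h1, show C = 1 by omega]; simp
      rw [hone, sub_self, mul_zero] at hstat
      rw [h]
      have : 0 ≤ T * Real.sqrt (Real.log S / (2 * ((k : ℝ) + 1))) := by positivity
      linarith
    · rw [h]
      have h3 : 2 * k ≤ N ^ k := by
        refine le_trans ?_ (Nat.pow_le_pow_left (show 2 ≤ N by omega) k)
        cases k with
        | zero => simp
        | succ k => rw [pow_succ]; have := Nat.lt_two_pow_self (n := k); omega
      have h3' : 2 * (k : ℝ) ≤ (N : ℝ) ^ k := by exact_mod_cast h3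
      linarith [P.hits_le hCN hS s₀ x T]

open Classical in
/-- The hits of Sage with learning rates tuned to at most `m s` misses at the state `s`. -/
theorem FSM.le_mul_sageHitRate [Fintype σ] (M : FSM N σ) (hC : 1 ≤ C) (hCN : C ≤ N) {D : ℝ}
    (hD : 1 ≤ D) (hK : Real.log (N.choose C) ≤ D - 1) (x : ℕ → Fin N) (T : ℕ) (m : σ → ℕ)
    (hm : ∀ s, M.optMissesAt C x T s ≤ m s) :
    T - ∑ s, (M.optMissesAt C x T s : ℝ) -
        Real.sqrt (2 * Fintype.card σ * D * ∑ s, (m s : ℝ)) -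
        Fintype.card σ * (D - 1 / 2) ≤
      T * M.sageHitRate C (fun s => hedgeRate D (m s)) x T := by
  set p : ℕ → ℝ := fun t => sageMarginal C
    (M.sageWeight (hedgeRate D (m (M.state x t))) x t (M.state x t)) (x t) with hp
  have hrate : ∑ t ∈ range T, p t ≤ T * M.sageHitRate C (fun s => hedgeRate D (m s)) x T := by
    rcases Nat.eq_zero_or_pos T with rfl | hT
    · simp
    rw [FSM.sageHitRate, mul_div_cancel₀ _ (by exact_mod_cast hT.ne')]
    refine sum_le_sum fun t _ => ?_
    have hw := M.sageWeight_pos (hedgeRate D (m (M.state x t))) x t (M.state x t)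
    exact le_volume_mem_madowSample (sageMarginal_nonneg hC hCN hw)
      (sageMarginal_le_one hC hCN hw) (sum_sageMarginal hC hCN hw) (x t)
  have hmiss : ∑ t ∈ range T, (1 - p t) ≤
      ∑ s, ((M.optMissesAt C x T s : ℝ) + Real.sqrt (2 * D * m s) + D - 1 / 2) := by
    rw [← sum_fiberwise (range T) (M.state x)]
    refine sum_le_sum fun s _ => ?_
    refine le_of_one_sub_exp_hedgeRate_mul_le hD hK (hm s) ?_
    refine le_trans (le_of_eq ?_) (M.one_sub_exp_mul_sage_misses_le hC hCN _ x s T)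
    congr 1
    exact sum_congr rfl fun t ht => by simp only [hp, (mem_filter.1 ht).2]
  have hcs : ∑ s, Real.sqrt (2 * D * m s) ≤
      Real.sqrt (2 * Fintype.card σ * D * ∑ s, (m s : ℝ)) := by
    have := Real.sum_sqrt_mul_sqrt_le (univ : Finset σ) (f := fun s => 2 * D * m s)
      (g := fun _ => 1) (fun s => by positivity) (fun _ => zero_le_one)
    simp only [Real.sqrt_one, mul_one, sum_const, card_univ, nsmul_eq_mul, ← mul_sum] at this
    refine this.trans (le_of_eq ?_)
    rw [← Real.sqrt_mul (by positivity)]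
    congr 1
    ring
  simp only [sum_sub_distrib, sum_add_distrib, sum_const, card_range, card_univ,
    nsmul_eq_mul, mul_one] at hmiss
  linarith

theorem mul_bestHitRate_sub_sageHitRate_le (hC : 1 ≤ C) (hCN : C ≤ N) {k : ℕ} (S T : ℕ)
    (s₀ : Fin k → Fin N) (m : (Fin k → Fin N) → ℕ) (x : ℕ → Fin N)
    (hm : ∀ s, (markovFSM k s₀).optMissesAt C x T s ≤ m s) :
    (T : ℝ) * (bestHitRate N C S x T - (markovFSM k s₀).sageHitRate C
        (fun s => hedgeRate (C * Real.log (N * Real.exp 1 / C)) (m s)) x T) ≤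
      T * min (1 - (C : ℝ) / N) (Real.sqrt (Real.log S / (2 * ((k : ℝ) + 1)))) +
      Real.sqrt (2 * (N : ℝ) ^ k * C * (∑ s, (m s : ℝ)) * Real.log (N * Real.exp 1 / C)) +
      (N : ℝ) ^ k * C * Real.log (N * Real.exp 1 / C) := by
  have hD := one_le_mul_log hC hCN
  set D := C * Real.log (N * Real.exp 1 / C) with hDdef
  have hsage := (markovFSM k s₀).le_mul_sageHitRate hC hCN hD (log_choose_le hC hCN) x T m hm
  have hstat := (markovFSM k s₀).sum_optMissesAt_le_mul hC hCN x T
  have hCN1 : (C : ℝ) / N ≤ 1 := div_le_one_of_le₀ (by exact_mod_cast hCN) (Nat.cast_nonneg _)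
  have hmin : 0 ≤ min (1 - (C : ℝ) / N) (Real.sqrt (Real.log S / (2 * ((k : ℝ) + 1)))) :=
    le_min (by linarith) (Real.sqrt_nonneg _)
  have hbest : T * bestHitRate N C S x T ≤
      T - ∑ s, ((markovFSM k s₀).optMissesAt C x T s : ℝ) +
      T * min (1 - (C : ℝ) / N) (Real.sqrt (Real.log S / (2 * ((k : ℝ) + 1)))) +
      (N : ℝ) ^ k / 2 := by
    set R := T - ∑ s, ((markovFSM k s₀).optMissesAt C x T s : ℝ) +
      T * min (1 - (C : ℝ) / N) (Real.sqrt (Real.log S / (2 * ((k : ℝ) + 1)))) +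
      (N : ℝ) ^ k / 2 with hR
    have hR0 : 0 ≤ R := by
      have h1 : (T : ℝ) * (1 - C / N) ≤ T :=
        mul_le_of_le_one_right (Nat.cast_nonneg _) (by linarith [show 0 ≤ (C : ℝ) / N by positivity])
      have h2 := mul_nonneg (Nat.cast_nonneg (α := ℝ) T) hmin
      have h3 : 0 ≤ (N : ℝ) ^ k / 2 := by positivity
      linarith
    rcases Nat.eq_zero_or_pos T with hT | hT
    · rw [hT, Nat.cast_zero, zero_mul]; exact hR0
    have hT0 : (0 : ℝ) < T := by exact_mod_cast hT
    rw [mul_comm, ← le_div_iff₀ hT0]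
    refine Real.sSup_le ?_ (by positivity)
    rintro r ⟨σ', hσ, P, hS, rfl⟩
    exact div_le_div_of_nonneg_right (P.hits_le_min hC hCN hS s₀ x T) hT0.le
  have hcard : (Fintype.card (Fin k → Fin N) : ℝ) = (N : ℝ) ^ k := by simp
  rw [hcard] at hsage
  have e1 : 2 * (N : ℝ) ^ k * C * (∑ s, (m s : ℝ)) * Real.log (N * Real.exp 1 / C) =
      2 * (N : ℝ) ^ k * D * ∑ s, (m s : ℝ) := by rw [hDdef]; ring
  have e2 : (N : ℝ) ^ k * C * Real.log (N * Real.exp 1 / C) = (N : ℝ) ^ k * D := by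
    rw [hDdef]; ring
  rw [e1, e2]
  linarith

end comparison

theorem theorem2 (N C : ℕ) (hC : 1 ≤ C) (hCN : C ≤ N) :
    ∃ η : ℕ → ℝ, (∀ m, 0 < η m) ∧
      ∀ (k S T : ℕ), 1 ≤ S → ∀ (s₀ : Fin k → Fin N),
        -- learning rates tuned to the misses of the best static cache at each state
        (∀ x : ℕ → Fin N,
          (T : ℝ) * (bestHitRate N C S x T -
              (markovFSM k s₀).sageHitRate C
                (fun s => η ((markovFSM k s₀).optMissesAt C x T s)) x T) ≤
            T * min (1 - (C : ℝ) / N) (Real.sqrt (Real.log S / (2 * ((k : ℝ) + 1)))) +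
            Real.sqrt (2 * (N : ℝ) ^ k * C * (markovFSM k s₀).optMisses C x T *
              Real.log (N * Real.exp 1 / C)) +
            (N : ℝ) ^ k * C * Real.log (N * Real.exp 1 / C)) ∧
        -- learning rates fixed in advance through upper bounds on these misses
        (∀ (m : (Fin k → Fin N) → ℕ) (x : ℕ → Fin N),
          (∀ s, (markovFSM k s₀).optMissesAt C x T s ≤ m s) →
          (T : ℝ) * (bestHitRate N C S x T -
              (markovFSM k s₀).sageHitRate C (fun s => η (m s)) x T) ≤
            T * min (1 - (C : ℝ) / N) (Real.sqrt (Real.log S / (2 * ((k : ℝ) + 1)))) +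
            Real.sqrt (2 * (N : ℝ) ^ k * C * (∑ s, (m s : ℝ)) *
              Real.log (N * Real.exp 1 / C)) +
            (N : ℝ) ^ k * C * Real.log (N * Real.exp 1 / C)) := by
  refine ⟨hedgeRate (C * Real.log (N * Real.exp 1 / C)), hedgeRate_pos (one_le_mul_log hC hCN),
    fun k S T _ s₀ => ⟨fun x => ?_, fun m x hm =>
      mul_bestHitRate_sub_sageHitRate_le hC hCN S T s₀ m x hm⟩⟩
  refine (mul_bestHitRate_sub_sageHitRate_le hC hCN S T s₀ _ x fun s => le_rfl).trans ?_
  have hlog : 0 ≤ Real.log (N * Real.exp 1 / C) := by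
    have hC0 : (0 : ℝ) < C := by exact_mod_cast hC
    exact (pos_of_mul_pos_right (zero_lt_one.trans_le (one_le_mul_log hC hCN)) hC0.le).le
  gcongr
  exact (markovFSM k s₀).sum_optMissesAt_le_optMisses hCN x T
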